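/- Let $f:\mathbb{R}^n\to\mathbb{R}\cup\{+\infty\}$ be a proper, lower semicontinuous, convex function and let $A\in\mathbb{R}^{m\times n}$. For $b\in\mathbb{R}^m$ let $$X=X(b):=\operatorname*{Arg\,min}_{x\in\mathbb{R}^n}\ f(x)+\tfrac12\|Ax-b\|^2$$ be the (possibly empty) set of minimizers. Let $\partial f$ denote the subdifferential of $f$, let $f^*(u)=\sup_{x}\big(\langle x,u\rangle-f(x)\big)$ be the conjugate of $f$, let $\operatorname{ran}\partial f=\bigcup_x\partial f(x)$ and $\operatorname{ran}A^\top=\{A^\top u:u\in\mathbb{R}^m\}$. Let $A\circ\partial f^*\circ A^\top:\mathbb{R}^m\to 2^{\mathbb{R}^m}$ be the set-valued operator $u\mapsto\{Ax: x\in\partial f^*(A^\top u)\}$, and write $\operatorname{ran}(I_m+A\circ\partial f^*\circ A^\top)=\{u+v: u\in\mathbb{R}^m,\ v\in(A\circ\partial f^*\circ A^\top)(u)\}$. A set-valued operator on $\mathbb{R}^m$ is maximally monotone if it is monotone and its graph is not properly contained in the graph of another monotone operator. Then: (i) If $\operatorname{ran}\partial f\cap\operatorname{ran}A^\top=\varnothing$,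 then $X(b)=\varnothing$ for every $b\in\mathbb{R}^m$. (ii) If $\operatorname{ran}\partial f\cap\operatorname{ran}A^\top\neq\varnothing$ and $A\circ\partial f^*\circ A^\top$ is not maximally monotone, then for every $b\in\mathbb{R}^m$: $X(b)\neq\varnothing$ if and only if $b\in\operatorname{ran}(I_m+A\circ\partial f^*\circ A^\top)$. (iii) $X(b)\neq\varnothing$ for every $b\in\mathbb{R}^m$ if and only if $\operatorname{ran}\partial f\cap\operatorname{ran}A^\top\neq\varnothing$ and $A\circ\partial f^*\circ A^\top$ is maximally monotone. -/

import Mathlib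

namespace RegLS

noncomputable section

section Abstract

variable {E F G : Type*}

/-- The range `ran T = {y | ∃ x, y ∈ T x}` of a set-valued operator `T : E → 2^F`. -/
def ran (T : E → Set F) : Set F := {y | ∃ x, y ∈ T x}

/-- The composition `L ∘ T ∘ M` of a set-valued operator `T` with single-valued maps `M` (inside)
and `L` (outside): `u ↦ {L x | x ∈ T (M u)}`. -/
def sandwich {H : Type*} (L : F → G) (T : E → Set F) (M : H → E) : H → Set G :=
  fun u => L '' T (M u)

/-- The operator `I + T : u ↦ {u + v | v ∈ T u}`. -/
def idAdd [Add E] (T : E → Set E) : E → Set E :=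
  fun u => {w | ∃ v ∈ T u, w = u + v}

/-- The extended-real-valued function `f` is proper: it never takes the value `-∞` and it is not
identically `+∞`. -/
def IsProper (f : E → EReal) : Prop :=
  (∀ x, f x ≠ ⊥) ∧ ∃ x, f x ≠ ⊤

end Abstract

section Inner

variable {E : Type*} [NormedAddCommGroup E] [InnerProductSpace ℝ E]

/-- The extended-real-valued function `f` is convex: its epigraph is a convex set. -/
def IsConvex (f : E → EReal) : Prop :=
  Convex ℝ {p : E × ℝ | f p.1 ≤ (p.2 : EReal)}

/-- The class `Γ₀(E)` of proper lower semicontinuous convex functions `f : E → ℝ ∪ {+∞}`. -/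
def GammaZero (f : E → EReal) : Prop :=
  IsProper f ∧ LowerSemicontinuous f ∧ IsConvex f

/-- The subdifferential
`∂f(x) = {u | f x + ⟪y - x, u⟫ ≤ f y for all y}`.
For proper `f` it is empty at every `x` with `f x = +∞`. -/
def subdiff (f : E → EReal) (x : E) : Set E :=
  {u | ∀ y, f x + ((inner ℝ (y - x) u : ℝ) : EReal) ≤ f y}

/-- The Fenchel conjugate `f*(u) = sup_x (⟪x, u⟫ - f x)`. -/
def conj (f : E → EReal) (u : E) : EReal :=
  ⨆ x, (((inner ℝ x u : ℝ) : EReal) - f x)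

/-- Monotonicity of the set-valued operator `T : E → 2^E`. -/
def MonotoneOp (T : E → Set E) : Prop :=
  ∀ x y, ∀ u ∈ T x, ∀ v ∈ T y, 0 ≤ (inner ℝ (x - y) (u - v) : ℝ)

/-- `T` is maximally monotone: it is monotone, and no monotone operator has a graph that
properly contains the graph of `T` (operators `E → Set E` are ordered by pointwise inclusion). -/
def MaximallyMonotone (T : E → Set E) : Prop :=
  Maximal MonotoneOp T

end Inner

section Matrices

variable {m n : ℕ}

/-- The map `ℝⁿ → ℝᵐ`, `x ↦ A x`, between Euclidean spaces. -/
abbrev mulE (A : Matrix (Fin m) (Fin n) ℝ) :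
    EuclideanSpace ℝ (Fin n) → EuclideanSpace ℝ (Fin m) :=
  fun x => Matrix.toEuclideanLin A x

/-- The objective function `x ↦ f x + (1/2) ‖A x - b‖²`. -/
def objective (f : EuclideanSpace ℝ (Fin n) → EReal) (A : Matrix (Fin m) (Fin n) ℝ)
    (b : EuclideanSpace ℝ (Fin m)) (x : EuclideanSpace ℝ (Fin n)) : EReal :=
  f x + (((1 / 2 : ℝ) * ‖mulE A x - b‖ ^ 2 : ℝ) : EReal)

/-- The solution set `X`: all global minimizers over `ℝⁿ` of `f x + (1/2) ‖A x - b‖²`. -/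
def solutionSet (f : EuclideanSpace ℝ (Fin n) → EReal) (A : Matrix (Fin m) (Fin n) ℝ)
    (b : EuclideanSpace ℝ (Fin m)) : Set (EuclideanSpace ℝ (Fin n)) :=
  {x | ∀ y, objective f A b x ≤ objective f A b y}

/-- The set-valued operator `A ∘ ∂f* ∘ Aᵀ : ℝᵐ → 2^(ℝᵐ)`. -/
def dualOp (f : EuclideanSpace ℝ (Fin n) → EReal) (A : Matrix (Fin m) (Fin n) ℝ) :
    EuclideanSpace ℝ (Fin m) → Set (EuclideanSpace ℝ (Fin m)) :=
  sandwich (mulE A) (subdiff (conj f)) (mulE A.transpose)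

end Matrices

end

end RegLS

open RegLS

/-!
Fermat's rule for `f + ½‖A · - b‖²` says that `x` is a minimizer exactly when
`Aᵀ (b - A x) ∈ ∂f(x)` (`minimizes_add_half_sq_iff`). For `f ∈ Γ₀` this membership can be inverted,
`w ∈ ∂f(x) ↔ x ∈ ∂f*(w)` (`mem_subdiff_conj_iff`, a consequence of Hahn–Banach separation from the
epigraph of `f`), so with `u = b - A x` a minimizer exists exactly when
`b ∈ ran (I + A ∘ ∂f* ∘ Aᵀ)` (`solutionSet_nonempty_iff`). The first two claims follow at once.

The third claim is Minty's criterion for the operator `T = A ∘ ∂f* ∘ Aᵀ`, which is always monotone.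
Surjectivity of `I + T` implies maximality by a short computation
(`MonotoneOp.maximallyMonotone_of_ran_idAdd`). For the converse the general theorem of Minty is not
needed: `T` is contained in the monotone operator `∂(f* ∘ Aᵀ)`, so it equals it when it is maximal,
and `I + ∂g` is surjective for a proper convex lower semicontinuous `g` with a subgradient, because
`g + ½‖· - b‖²` is coercive and hence attains its minimum (`mem_ran_idAdd_subdiff`), to which
Fermat's rule applies.
-/

namespace RegLS

open scoped RealInnerProductSpace

section Convex

variable {E F : Type*} [NormedAddCommGroup E] [InnerProductSpace ℝ E]
  [NormedAddCommGroup F] [InnerProductSpace ℝ F]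

/-! ### Subgradients and conjugates in terms of real numbers -/

lemma IsProper.exists_le_coe {X : Type*} {f : X → EReal} (hf : IsProper f) : ∃ x, ∃ r : ℝ, f x ≤ r := by
  obtain ⟨x, hx⟩ := hf.2
  exact ⟨x, (f x).toReal, EReal.le_coe_toReal hx⟩

lemma exists_coe_eq_of_le {a : EReal} (ha : a ≠ ⊥) {s : ℝ} (h : a ≤ s) : ∃ r : ℝ, a = r ∧ r ≤ s := by
  induction a with
  | bot => exact absurd rfl ha
  | top => simp at h
  | coe r => exact ⟨r, rfl, by exact_mod_cast h⟩

lemma le_of_forall_le_coe {a b : EReal} (h : ∀ s : ℝ, b ≤ s → a ≤ s) : a ≤ b :=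
  EReal.le_of_forall_lt_iff_le.1 fun s hs => h s hs.le

lemma exists_coe_of_mem_subdiff {f : E → EReal} (hf : IsProper f) {x u : E}
    (hu : u ∈ subdiff f x) : ∃ r : ℝ, f x = r := by
  obtain ⟨z, s, hz⟩ := hf.exists_le_coe
  have h := (hu z).trans hz
  have hx := hf.1 x
  generalize f x = a at h hx
  induction a with
  | bot => exact absurd rfl hx
  | top => simp at h
  | coe r => exact ⟨r, rfl⟩

lemma mem_subdiff_iff_of_eq_coe {f : E → EReal} {x u : E} {r : ℝ} (hx : f x = r) :
    u ∈ subdiff f x ↔ ∀ z, ∀ s : ℝ, f z ≤ s → r + ⟪z - x, u⟫ ≤ s := by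
  constructor
  · intro h z s hs
    have := (h z).trans hs
    rw [hx] at this
    exact_mod_cast this
  · intro h z
    refine le_of_forall_le_coe fun s hs => ?_
    rw [hx]
    exact_mod_cast h z s hs

lemma conj_le_coe_iff {f : E → EReal} {u : E} {c : ℝ} :
    conj f u ≤ c ↔ ∀ z, ∀ s : ℝ, f z ≤ s → ⟪z, u⟫ - s ≤ c := by
  rw [conj, iSup_le_iff]
  refine forall_congr' fun z => ?_
  induction f z with
  | bot =>
    refine iff_of_false (by simp) fun h => ?_
    have := h (⟪z, u⟫ - c - 1) bot_le
    linarith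
  | top => simp
  | coe r =>
    constructor
    · intro h s hs
      have h1 : ⟪z, u⟫ - r ≤ c := by exact_mod_cast h
      have h2 : r ≤ s := by exact_mod_cast hs
      linarith
    · intro h
      exact_mod_cast h r le_rfl

lemma conj_ne_bot {f : E → EReal} (hf : IsProper f) (u : E) : conj f u ≠ ⊥ := by
  obtain ⟨z, s, hz⟩ := hf.exists_le_coe
  intro h
  have h1 : ⟪z, u⟫ - s ≤ ⟪z, u⟫ - s - 1 :=
    conj_le_coe_iff.1 (h.trans_le bot_le) z s hz
  linarith

lemma isConvex_conj (f : E → EReal) : IsConvex (conj f) := by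
  rintro ⟨u, c⟩ hu ⟨v, d⟩ hv a b ha hb hab
  simp only [Set.mem_ofPred_eq, conj_le_coe_iff] at hu hv
  simp only [Set.mem_ofPred_eq, Prod.fst_add, Prod.snd_add, Prod.smul_fst, Prod.smul_snd,
    conj_le_coe_iff, inner_add_right, inner_smul_right, smul_eq_mul]
  intro z s hs
  have h1 := mul_le_mul_of_nonneg_left (hu z s hs) ha
  have h2 := mul_le_mul_of_nonneg_left (hv z s hs) hb
  have h3 : s = a * s + b * s := by rw [← add_mul, hab, one_mul]
  linarith

lemma lowerSemicontinuous_conj (f : E → EReal) : LowerSemicontinuous (conj f) := by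
  refine lowerSemicontinuous_iSup fun z => ?_
  induction f z with
  | bot => simpa using lowerSemicontinuous_const
  | top => simpa using lowerSemicontinuous_const
  | coe r =>
    have : Continuous fun u : E => (((⟪z, u⟫ - r : ℝ)) : EReal) :=
      continuous_coe_real_ereal.comp (by fun_prop)
    simpa using this.lowerSemicontinuous

lemma IsConvex.comp_linearMap {g : F → EReal} (hg : IsConvex g) (L : E →ₗ[ℝ] F) :
    IsConvex fun x => g (L x) := by
  rintro ⟨x, r⟩ hx ⟨y, s⟩ hy a b ha hb hab
  have := @hg (L x, r) hx (L y, s) hy a b ha hb hab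
  simpa using this

/-! ### Inversion of the subdifferential -/

/-- Strict separation of a point from the closed convex epigraph of `f`. The coefficient `q` of the
vertical coordinate is nonnegative since epigraphs are unbounded upwards. -/
lemma GammaZero.exists_separation [CompleteSpace E] {f : E → EReal} (hf : GammaZero f) {x : E}
    {t : ℝ} (hx : ¬ f x ≤ t) :
    ∃ (p : E) (q c : ℝ), 0 ≤ q ∧ ⟪x, p⟫ + q * t < c ∧
      ∀ z, ∀ s : ℝ, f z ≤ s → c < ⟪z, p⟫ + q * s := by
  obtain ⟨hprop, hlsc, hconv⟩ := hf
  have hcl : IsClosed {p : E × ℝ | f p.1 ≤ (p.2 : EReal)} :=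
    hlsc.isClosed_epigraph.preimage
      (continuous_fst.prodMk (continuous_coe_real_ereal.comp continuous_snd))
  obtain ⟨l, c, hlx, hl⟩ :=
    geometric_hahn_banach_point_closed (x := (x, t)) hconv hcl (by simpa using hx)
  have hrep : ∀ z : E, ∀ s : ℝ, l (z, s) =
      ⟪z, (InnerProductSpace.toDual ℝ E).symm (l.comp (ContinuousLinearMap.inl ℝ E ℝ))⟫ +
        l (0, 1) * s := by
    intro z s
    rw [real_inner_comm, InnerProductSpace.toDual_symm_apply]
    have : (z, s) = (z, 0) + s • ((0, 1) : E × ℝ) := by simp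
    rw [this, map_add, map_smul]
    simp [mul_comm]
  generalize (InnerProductSpace.toDual ℝ E).symm (l.comp (ContinuousLinearMap.inl ℝ E ℝ)) = p
    at hrep
  generalize l (0, 1) = q at hrep
  have hl' : ∀ z, ∀ s : ℝ, f z ≤ s → c < ⟪z, p⟫ + q * s := fun z s hs => by
    rw [← hrep]
    exact hl (z, s) hs
  refine ⟨p, q, c, ?_, by rwa [← hrep], hl'⟩
  by_contra! hq
  obtain ⟨z, s, hz⟩ := hprop.exists_le_coe
  -- If `q < 0`, the functional takes the value `c` on the epigraph, far above `(z, s)`.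
  set k := (⟪z, p⟫ + q * s - c) / (-q) with hk
  have hk0 : 0 ≤ k := div_nonneg (by linarith [hl' z s hz]) (by linarith)
  have h1 := hl' z (s + k) (hz.trans (by exact_mod_cast (by linarith : s ≤ s + k)))
  have h2 : q * k = -(⟪z, p⟫ + q * s - c) := by
    rw [hk]
    field_simp [hq.ne]
  nlinarith

lemma conj_neg_inv_smul_le {f : E → EReal} {p : E} {q c : ℝ} (hq : 0 < q)
    (h : ∀ z, ∀ s : ℝ, f z ≤ s → c < ⟪z, p⟫ + q * s) : conj f (-(q⁻¹ • p)) ≤ (-(q⁻¹ * c) : ℝ) := by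
  rw [conj_le_coe_iff]
  intro z s hs
  have h1 := mul_lt_mul_of_pos_left (h z s hs) (inv_pos.2 hq)
  have h2 : q⁻¹ * (⟪z, p⟫ + q * s) = q⁻¹ * ⟪z, p⟫ + s := by field_simp
  rw [inner_neg_right, inner_smul_right]
  linarith

/-- A function in `Γ₀` has a continuous affine minorant, so its conjugate is proper. -/
lemma GammaZero.isProper_conj [CompleteSpace E] {f : E → EReal} (hf : GammaZero f) :
    IsProper (conj f) := by
  refine ⟨conj_ne_bot hf.1, ?_⟩
  obtain ⟨x, s, hx⟩ := hf.1.exists_le_coe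
  obtain ⟨r, hr, -⟩ := exists_coe_eq_of_le (hf.1.1 x) hx
  have hlt : ¬ f x ≤ ((r - 1 : ℝ) : EReal) := by
    rw [hr, EReal.coe_le_coe_iff]
    linarith
  obtain ⟨p, q, c, -, hpx, hp⟩ := hf.exists_separation hlt
  have hq : 0 < q := by linarith [hp x r hr.le]
  exact ⟨_, ne_top_of_le_ne_top (EReal.coe_ne_top _) (conj_neg_inv_smul_le hq hp)⟩

/-- If `x ∈ ∂f*(w)`, then `f` and `f*` satisfy the Fenchel–Young equality at `(x, w)`. -/
lemma GammaZero.le_of_mem_subdiff_conj [CompleteSpace E] {f : E → EReal} (hf : GammaZero f)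
    {x w : E} {c : ℝ} (hc : conj f w = c) (hx : x ∈ subdiff (conj f) w) :
    f x ≤ ((⟪x, w⟫ - c : ℝ) : EReal) := by
  rw [mem_subdiff_iff_of_eq_coe hc] at hx
  by_contra hlt
  obtain ⟨p, q, d, hq, hpx, hp⟩ := hf.exists_separation hlt
  rcases hq.eq_or_lt with rfl | hq
  · -- A vertical hyperplane separates `x` from the domain of `f`, and moving `w` in the direction
    -- `-p` decreases `f*` faster than the subgradient `x` permits.
    have h1 : conj f (w - p) ≤ ((c - d : ℝ) : EReal) := by
      rw [conj_le_coe_iff]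
      intro z s hs
      have h2 := conj_le_coe_iff.1 hc.le z s hs
      have h3 := hp z s hs
      rw [inner_sub_right]
      linarith
    have h4 := hx _ _ h1
    rw [sub_sub_cancel_left, inner_neg_left, real_inner_comm] at h4
    linarith
  · -- The hyperplane is the graph of an affine minorant of `f` that exceeds `⟪x, w⟫ - c` at `x`.
    have h4 := hx _ _ (conj_neg_inv_smul_le hq hp)
    rw [inner_sub_left, inner_neg_left, real_inner_smul_left, real_inner_comm x p,
      real_inner_comm x w] at h4
    have h5 := mul_lt_mul_of_pos_left hpx (inv_pos.2 hq)
    have h6 : q⁻¹ * (⟪x, p⟫ + q * (⟪x, w⟫ - c)) = q⁻¹ * ⟪x, p⟫ + (⟪x, w⟫ - c) := by field_simp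
    linarith

lemma mem_subdiff_conj_iff [CompleteSpace E] {f : E → EReal} (hf : GammaZero f) {x w : E} :
    x ∈ subdiff (conj f) w ↔ w ∈ subdiff f x := by
  constructor
  · intro hx
    obtain ⟨c, hc⟩ := exists_coe_of_mem_subdiff hf.isProper_conj hx
    obtain ⟨r, hr, hrc⟩ := exists_coe_eq_of_le (hf.1.1 x) (hf.le_of_mem_subdiff_conj hc hx)
    rw [mem_subdiff_iff_of_eq_coe hr]
    intro z s hs
    have := conj_le_coe_iff.1 hc.le z s hs
    rw [inner_sub_left]
    linarith
  · intro hw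
    obtain ⟨r, hr⟩ := exists_coe_of_mem_subdiff hf.1 hw
    rw [mem_subdiff_iff_of_eq_coe hr] at hw
    have hle : conj f w ≤ ((⟪x, w⟫ - r : ℝ) : EReal) := by
      rw [conj_le_coe_iff]
      intro z s hs
      have := hw z s hs
      rw [inner_sub_left] at this
      linarith
    obtain ⟨c, hc, hcr⟩ := exists_coe_eq_of_le (conj_ne_bot hf.1 w) hle
    rw [mem_subdiff_iff_of_eq_coe hc]
    intro y s hs
    have := conj_le_coe_iff.1 hs x r hr.le
    rw [inner_sub_left, real_inner_comm x y, real_inner_comm x w]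
    linarith

/-! ### Minimizing a convex function plus a least squares term -/

/-- Fermat's rule for a convex function plus a least squares term; `M` is the adjoint of `L`. -/
lemma minimizes_add_half_sq_iff {f : E → EReal} (hf : IsProper f) (hconv : IsConvex f)
    (L : E →ₗ[ℝ] F) (M : F → E) (hM : ∀ x u, ⟪x, M u⟫ = ⟪L x, u⟫) (b : F) (x : E) :
    (∀ y, f x + ((1 / 2 * ‖L x - b‖ ^ 2 : ℝ) : EReal) ≤
      f y + ((1 / 2 * ‖L y - b‖ ^ 2 : ℝ) : EReal)) ↔ M (b - L x) ∈ subdiff f x := by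
  have hexp : ∀ d : E, ‖L (x + d) - b‖ ^ 2 =
      ‖L x - b‖ ^ 2 - 2 * ⟪d, M (b - L x)⟫ + ‖L d‖ ^ 2 := by
    intro d
    rw [hM, map_add, show L x + L d - b = (L x - b) + L d by abel, norm_add_sq_real,
      ← neg_sub (L x) b, inner_neg_right, real_inner_comm]
    ring
  constructor
  · intro h
    obtain ⟨r, hr⟩ : ∃ r : ℝ, f x = r := by
      obtain ⟨z, s, hz⟩ := hf.exists_le_coe
      have h1 := (h z).trans (add_le_add_left hz _)
      have hx := hf.1 x
      generalize f x = a at h1 hx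
      induction a with
      | bot => exact absurd rfl hx
      | top =>
        rw [EReal.top_add_coe, ← EReal.coe_add] at h1
        simp only [top_le_iff, EReal.coe_ne_top] at h1
      | coe r => exact ⟨r, rfl⟩
    rw [mem_subdiff_iff_of_eq_coe hr]
    intro y s hs
    -- Compare `x` with the points `x + t (y - x)` and let `t` tend to `0`.
    have key : ∀ t : ℝ, 0 < t → t ≤ 1 →
        r + ⟪y - x, M (b - L x)⟫ ≤ s + t * (1 / 2 * ‖L (y - x)‖ ^ 2) := by
      intro t ht ht1
      have h1 : f (x + t • (y - x)) ≤ (((1 - t) * r + t * s : ℝ) : EReal) := by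
        have := @hconv (x, r) hr.le (y, s) hs (1 - t) t (by linarith) ht.le (by ring)
        have e : (1 - t) • x + t • y = x + t • (y - x) := by module
        simpa [e] using this
      have h2 := (h (x + t • (y - x))).trans (add_le_add_left h1 _)
      rw [hr] at h2
      have h3 : r + 1 / 2 * ‖L x - b‖ ^ 2 ≤
          (1 - t) * r + t * s + 1 / 2 * ‖L (x + t • (y - x)) - b‖ ^ 2 := by exact_mod_cast h2
      rw [hexp, map_smul, norm_smul, mul_pow, real_inner_smul_left, Real.norm_eq_abs, sq_abs] at h3
      have h4 : t * (r + ⟪y - x, M (b - L x)⟫) ≤ t * (s + t * (1 / 2 * ‖L (y - x)‖ ^ 2)) := by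
        linarith
      exact le_of_mul_le_mul_left h4 ht
    have hlim : Filter.Tendsto (fun t : ℝ => s + t * (1 / 2 * ‖L (y - x)‖ ^ 2))
        (nhdsWithin 0 (Set.Ioi 0)) (nhds s) := by
      have : Continuous fun t : ℝ => s + t * (1 / 2 * ‖L (y - x)‖ ^ 2) := by fun_prop
      simpa using (this.tendsto 0).mono_left nhdsWithin_le_nhds
    refine ge_of_tendsto hlim ?_
    filter_upwards [Ioc_mem_nhdsGT (zero_lt_one (α := ℝ))] with t ht
    exact key t ht.1 ht.2
  · intro h y
    obtain ⟨r, hr⟩ := exists_coe_of_mem_subdiff hf h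
    rw [mem_subdiff_iff_of_eq_coe hr] at h
    have h1 := h y
    have h2 := hexp (y - x)
    rw [add_sub_cancel] at h2
    have hy := hf.1 y
    rw [hr]
    generalize f y = a at h1 hy
    induction a with
    | bot => exact absurd rfl hy
    | top =>
      rw [EReal.top_add_coe]
      exact le_top
    | coe s =>
      have h3 := h1 s le_rfl
      have h4 : r + 1 / 2 * ‖L x - b‖ ^ 2 ≤ s + 1 / 2 * ‖L y - b‖ ^ 2 := by
        nlinarith [sq_nonneg ‖L (y - x)‖]
      exact_mod_cast h4

lemma monotoneOp_subdiff {f : E → EReal} (hf : IsProper f) : MonotoneOp (subdiff f) := by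
  intro x y u hu v hv
  obtain ⟨r, hr⟩ := exists_coe_of_mem_subdiff hf hu
  obtain ⟨s, hs⟩ := exists_coe_of_mem_subdiff hf hv
  have h1 := (mem_subdiff_iff_of_eq_coe hr).1 hu y s hs.le
  have h2 := (mem_subdiff_iff_of_eq_coe hs).1 hv x r hr.le
  rw [← neg_sub x y, inner_neg_left] at h1
  rw [inner_sub_right]
  linarith

/-- If a convex lower semicontinuous `g` has a subgradient anywhere, then `I + ∂g` is surjective:
the subgradient makes `g + ½‖· - b‖²` coercive, so that it has a minimizer. -/
lemma mem_ran_idAdd_subdiff [ProperSpace E] {g : E → EReal} (hg : IsProper g)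
    (hlsc : LowerSemicontinuous g) (hconv : IsConvex g) {u₀ v : E} (hv : v ∈ subdiff g u₀) (b : E) :
    b ∈ ran (idAdd (subdiff g)) := by
  obtain ⟨r, hr⟩ := exists_coe_of_mem_subdiff hg hv
  rw [mem_subdiff_iff_of_eq_coe hr] at hv
  have hh : LowerSemicontinuous fun u => g u + ((1 / 2 * ‖u - b‖ ^ 2 : ℝ) : EReal) := by
    have hc : Continuous fun u : E => ((1 / 2 * ‖u - b‖ ^ 2 : ℝ) : EReal) :=
      continuous_coe_real_ereal.comp (by fun_prop)
    exact hlsc.add' hc.lowerSemicontinuous fun u =>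
      EReal.continuousAt_add (Or.inr (EReal.coe_ne_bot _)) (Or.inr (EReal.coe_ne_top _))
  -- By the subgradient inequality, the objective at `u₀ + d` exceeds its value at `u₀` by at least
  -- `½‖d‖² + ⟪d, v + (u₀ - b)⟫`, which is nonnegative outside the ball of radius `R`.
  set R : ℝ := 2 * ‖v + (u₀ - b)‖ with hR
  have hR0 : 0 ≤ R := by positivity
  obtain ⟨u, -, hu⟩ := (hh.lowerSemicontinuousOn _).exists_isMinOn
    ⟨u₀, Metric.mem_closedBall_self hR0⟩ (isCompact_closedBall u₀ R)
  rw [isMinOn_iff] at hu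
  have hmin : ∀ y, g u + ((1 / 2 * ‖u - b‖ ^ 2 : ℝ) : EReal) ≤
      g y + ((1 / 2 * ‖y - b‖ ^ 2 : ℝ) : EReal) := by
    intro y
    by_cases hy : y ∈ Metric.closedBall u₀ R
    · exact hu y hy
    refine (hu u₀ (Metric.mem_closedBall_self hR0)).trans ?_
    rw [Metric.mem_closedBall, not_le, dist_eq_norm] at hy
    have h1 := hv y
    have hyb := hg.1 y
    rw [hr]
    generalize g y = a at h1 hyb
    induction a with
    | bot => exact absurd rfl hyb
    | top =>
      rw [EReal.top_add_coe]
      exact le_top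
    | coe s =>
      have h2 := h1 s le_rfl
      have h3 : ‖y - b‖ ^ 2 = ‖y - u₀‖ ^ 2 + 2 * ⟪y - u₀, u₀ - b⟫ + ‖u₀ - b‖ ^ 2 := by
        rw [← norm_add_sq_real, sub_add_sub_cancel]
      have h4 := (abs_le.1 (abs_real_inner_le_norm (y - u₀) (v + (u₀ - b)))).1
      rw [inner_add_right] at h4
      have h5 : 0 ≤ ‖y - u₀‖ * (‖y - u₀‖ - R) := mul_nonneg (norm_nonneg _) (by linarith)
      have h6 : r + 1 / 2 * ‖u₀ - b‖ ^ 2 ≤ s + 1 / 2 * ‖y - b‖ ^ 2 := by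
        rw [h3]
        nlinarith
      exact_mod_cast h6
  have hsub := (minimizes_add_half_sq_iff hg hconv LinearMap.id id (fun _ _ => rfl) b u).1 hmin
  exact ⟨u, _, hsub, (add_sub_cancel u b).symm⟩

/-- The elementary half of Minty's theorem. -/
lemma MonotoneOp.maximallyMonotone_of_ran_idAdd {T : E → Set E} (hT : MonotoneOp T)
    (h : ∀ b, b ∈ ran (idAdd T)) : MaximallyMonotone T := by
  refine ⟨hT, fun S hS hTS x y hy => ?_⟩
  obtain ⟨u, v, hv, hxy⟩ := h (x + y)
  have h1 := hS x u y hy v (hTS u hv)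
  have h2 : y - v = -(x - u) := by
    rw [sub_eq_iff_eq_add, neg_sub, sub_add_eq_add_sub, ← hxy, add_sub_cancel_left]
  rw [h2, inner_neg_right, real_inner_self_eq_norm_sq] at h1
  have h3 : ‖x - u‖ = 0 := by
    refine pow_eq_zero_iff two_ne_zero |>.1 (le_antisymm (by linarith) (sq_nonneg _))
  obtain rfl : x = u := sub_eq_zero.1 (norm_eq_zero.1 h3)
  obtain rfl : y = v := add_left_cancel hxy
  exact hv

end Convex

/-! ### The regularized least squares problem -/

section Matrices

variable {m n : ℕ} {f : EuclideanSpace ℝ (Fin n) → EReal} {A : Matrix (Fin m) (Fin n) ℝ}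

lemma inner_mulE_transpose (A : Matrix (Fin m) (Fin n) ℝ) (x : EuclideanSpace ℝ (Fin n))
    (u : EuclideanSpace ℝ (Fin m)) : ⟪x, mulE A.transpose u⟫ = ⟪mulE A x, u⟫ := by
  have h := Matrix.toEuclideanLin_conjTranspose_eq_adjoint A
  rw [Matrix.conjTranspose_eq_transpose_of_trivial] at h
  rw [mulE, h, LinearMap.adjoint_inner_right]

lemma mem_solutionSet_iff (hf : GammaZero f) (b : EuclideanSpace ℝ (Fin m))
    (x : EuclideanSpace ℝ (Fin n)) :
    x ∈ solutionSet f A b ↔ mulE A.transpose (b - mulE A x) ∈ subdiff f x :=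
  minimizes_add_half_sq_iff hf.1 hf.2.2 (Matrix.toEuclideanLin A) (mulE A.transpose)
    (inner_mulE_transpose A) b x

/-- A minimizer `x` corresponds to the decomposition `b = u + A x` with `u = b - A x`. -/
lemma solutionSet_nonempty_iff (hf : GammaZero f) (b : EuclideanSpace ℝ (Fin m)) :
    (solutionSet f A b).Nonempty ↔ b ∈ ran (idAdd (dualOp f A)) := by
  constructor
  · rintro ⟨x, hx⟩
    rw [mem_solutionSet_iff hf, ← mem_subdiff_conj_iff hf] at hx
    exact ⟨b - mulE A x, mulE A x, ⟨x, hx, rfl⟩, (sub_add_cancel _ _).symm⟩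
  · rintro ⟨u, _, ⟨x, hx, rfl⟩, rfl⟩
    refine ⟨x, ?_⟩
    rw [mem_solutionSet_iff hf, ← mem_subdiff_conj_iff hf, add_sub_cancel_right]
    exact hx

/-- One half of the chain rule: `A ∘ ∂f* ∘ Aᵀ ⊆ ∂(f* ∘ Aᵀ)`. -/
lemma dualOp_le_subdiff (f : EuclideanSpace ℝ (Fin n) → EReal) (A : Matrix (Fin m) (Fin n) ℝ) :
    dualOp f A ≤ subdiff fun u => conj f (mulE A.transpose u) := by
  rintro u _ ⟨x, hx, rfl⟩ y
  have h := hx (mulE A.transpose y)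
  rwa [← map_sub, real_inner_comm, inner_mulE_transpose, real_inner_comm] at h

lemma monotoneOp_dualOp (hf : GammaZero f) : MonotoneOp (dualOp f A) := by
  rintro u v _ ⟨x, hx, rfl⟩ _ ⟨y, hy, rfl⟩
  have h := monotoneOp_subdiff hf.isProper_conj _ _ x hx y hy
  have hA : mulE A (x - y) = mulE A x - mulE A y := map_sub _ _ _
  rwa [← map_sub, real_inner_comm, inner_mulE_transpose, hA, real_inner_comm] at h

lemma mem_ran_idAdd_dualOp (hf : GammaZero f)
    (hne : (ran (subdiff f) ∩ Set.range (mulE A.transpose)).Nonempty)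
    (hmax : MaximallyMonotone (dualOp f A)) (b : EuclideanSpace ℝ (Fin m)) :
    b ∈ ran (idAdd (dualOp f A)) := by
  obtain ⟨_, ⟨x, hx⟩, ⟨u, rfl⟩⟩ := hne
  rw [← mem_subdiff_conj_iff hf] at hx
  have hproper : IsProper fun u => conj f (mulE A.transpose u) := by
    obtain ⟨c, hc⟩ := exists_coe_of_mem_subdiff hf.isProper_conj hx
    exact ⟨fun u => conj_ne_bot hf.1 _, u, hc.trans_ne (EReal.coe_ne_top c)⟩
  have hle := dualOp_le_subdiff f A
  rw [hle.antisymm (hmax.2 (monotoneOp_subdiff hproper) hle)]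
  refine mem_ran_idAdd_subdiff hproper ?_
    ((isConvex_conj f).comp_linearMap (Matrix.toEuclideanLin A.transpose))
    (hle u ⟨x, hx, rfl⟩) b
  exact (lowerSemicontinuous_conj f).comp (LinearMap.continuous_of_finiteDimensional _)

end Matrices

end RegLS

open RegLS
theorem corollary2p5 {m n : ℕ} (f : EuclideanSpace ℝ (Fin n) → EReal) (hf : GammaZero f)
    (A : Matrix (Fin m) (Fin n) ℝ) :
    (ran (subdiff f) ∩ Set.range (mulE A.transpose) = ∅ →
      ∀ b : EuclideanSpace ℝ (Fin m), solutionSet f A b = ∅) ∧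
    ((ran (subdiff f) ∩ Set.range (mulE A.transpose)).Nonempty →
      ¬ MaximallyMonotone (dualOp f A) →
      ∀ b : EuclideanSpace ℝ (Fin m),
        (solutionSet f A b).Nonempty ↔ b ∈ ran (idAdd (dualOp f A))) ∧
    ((∀ b : EuclideanSpace ℝ (Fin m), (solutionSet f A b).Nonempty) ↔
      (ran (subdiff f) ∩ Set.range (mulE A.transpose)).Nonempty ∧
        MaximallyMonotone (dualOp f A)) := by
  have hne : ∀ b, (solutionSet f A b).Nonempty →
      (ran (subdiff f) ∩ Set.range (mulE A.transpose)).Nonempty := by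
    rintro b ⟨x, hx⟩
    exact ⟨_, ⟨x, (mem_solutionSet_iff hf b x).1 hx⟩, _, rfl⟩
  refine ⟨fun h b => ?_, fun _ _ b => solutionSet_nonempty_iff hf b, fun h => ⟨hne 0 (h 0), ?_⟩, ?_⟩
  · by_contra hb
    exact (hne b (Set.nonempty_iff_ne_empty.2 hb)).ne_empty h
  · exact (monotoneOp_dualOp hf).maximallyMonotone_of_ran_idAdd
      fun b => (solutionSet_nonempty_iff hf b).1 (h b)
  · rintro ⟨hne, hmax⟩ b
    exact (solutionSet_nonempty_iff hf b).2 (mem_ran_idAdd_dualOp hf hne hmax b)
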